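/- Let $S^1$ be the circle and let $\mathrm{Diff}^\omega_+(S^1)$ be the group of orientation-preserving real analytic diffeomorphisms of $S^1$. Let $\Gamma$ be a subgroup of $\mathrm{Diff}^\omega_+(S^1)$ which is locally nondiscrete with respect to the $C^0$-topology, i.e. there exist a nonempty open interval $I\subset S^1$ and a sequence of elements of $\Gamma\setminus\{\mathrm{id}\}$ which converges to the identity on $I$ in the $C^0$-topology (uniformly on compact subsets of $I$). Then $\Gamma$ has no exceptional minimal set, i.e. there is no set $C\subset S^1$ that is homeomorphic to a Cantor set and is minimal (with respect to inclusion) among the nonempty closed $\Gamma$-invariant subsets of $S^1$. -/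

import Mathlib

open scoped Manifold ContDiff

/-- A homeomorphism of the circle preserves the orientation if it is covered, through the universal
cover `t ↦ exp (i t)`, by an increasing homeomorphism of the line which commutes with the
deck translation `t ↦ t + 2π`. (An order isomorphism of `ℝ` is an increasing homeomorphism.) -/
def IsOrientationPreserving (f : Circle ≃ₜ Circle) : Prop :=
  ∃ F : ℝ ≃o ℝ, (∀ t, F (t + 2 * Real.pi) = F t + 2 * Real.pi) ∧
    ∀ t, f (Circle.exp t) = Circle.exp (F t)

/-- The group of orientation-preserving real analytic diffeomorphisms of the circle, as a subgroup
of the group of homeomorphisms. Smoothness of order `ω` is real analyticity. -/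
def AnalyticDiffPlus : Subgroup (Circle ≃ₜ Circle) where
  carrier := {f | ContMDiff (𝓡 1) (𝓡 1) ω (f : Circle → Circle) ∧
    ContMDiff (𝓡 1) (𝓡 1) ω (f.symm : Circle → Circle) ∧ IsOrientationPreserving f}
  mul_mem' := by
    rintro f g ⟨hf, hf', F, hF, hfF⟩ ⟨hg, hg', G, hG, hgG⟩
    refine ⟨hf.comp hg, hg'.comp hf', G.trans F, fun t => ?_, fun t => ?_⟩
    · simp [hG, hF]
    · simp [hgG, hfF]
  one_mem' := ⟨contMDiff_id, contMDiff_id, OrderIso.refl ℝ, fun _ => rfl, fun _ => rfl⟩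
  inv_mem' := by
    rintro f ⟨hf, hf', F, hF, hfF⟩
    refine ⟨hf', hf, F.symm, fun t => ?_, fun t => ?_⟩
    · rw [F.symm_apply_eq, hF, F.apply_symm_apply]
    · change f.symm _ = _
      rw [f.symm_apply_eq, hfF, F.apply_symm_apply]

/-- An open interval in the circle: a nondegenerate open arc `{exp (i t) : a < t < b}`. -/
def IsOpenArc (I : Set Circle) : Prop :=
  ∃ a b : ℝ, a < b ∧ b ≤ a + 2 * Real.pi ∧ I = Circle.exp '' Set.Ioo a b

/-- Local nondiscreteness with respect to the `C⁰`-topology: some sequence of nontrivial elements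
of `Γ` converges to the identity on some open interval, uniformly on its compact subsets.
(Passing to a smaller interval, the convergence may equivalently be taken uniform.) -/
def IsLocallyNondiscreteC0 (Γ : Subgroup AnalyticDiffPlus) : Prop :=
  ∃ I : Set Circle, IsOpenArc I ∧ ∃ g : ℕ → AnalyticDiffPlus, (∀ n, g n ∈ Γ ∧ g n ≠ 1) ∧
    TendstoLocallyUniformlyOn (fun n x => (g n : Circle ≃ₜ Circle) x) id Filter.atTop I

/-- The subset `C` of the circle is nonempty, closed and `Γ`-invariant. -/
structure IsClosedInvariant (Γ : Subgroup AnalyticDiffPlus) (C : Set Circle) : Prop where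
  nonempty : C.Nonempty
  isClosed : IsClosed C
  invariant : ∀ f ∈ Γ, ∀ x ∈ C, (f : Circle ≃ₜ Circle) x ∈ C

/-- A minimal set of `Γ`: minimal for inclusion among the nonempty closed `Γ`-invariant sets. -/
def IsMinimalSet (Γ : Subgroup AnalyticDiffPlus) (C : Set Circle) : Prop :=
  Minimal (IsClosedInvariant Γ) C

/-- An exceptional minimal set of `Γ`: a minimal set which is homeomorphic to the Cantor set. -/
def IsExceptionalMinimalSet (Γ : Subgroup AnalyticDiffPlus) (C : Set Circle) : Prop :=
  IsMinimalSet Γ C ∧ Nonempty (C ≃ₜ cantorSet)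

/-! Suppose `C` is exceptional. Its preimage in the line has empty interior, so some gap `(p, q)` of
it meets the interval of convergence. Choose `t` in both: an element moving `t` little has a lift
that sends `t` into the gap, hence fixes `q`. The lifts fixing `q` form a cyclic group
(`exists_generator_of_fixed_of_invariant`), and nontrivial powers of a generator not fixing `t` move
`t` by a definite amount (`OrderIso.abs_zpow_apply_sub_ge`). So the nontrivial elements cannot
converge to the identity at `t`.

Cyclicity comes from ordering germs at `q`. If `F` contracts towards `q` and `g` is so weak a
contraction that `F ≤ g ^ N`, conjugating by a high power of `F` carries `g` to a fixed scale with
bounded distortion. There the images of one gap under the first powers are disjoint and of length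
bounded below, which bounds `N` independently of `g` (`exists_pow_bound`). -/

open Filter Topology Set

/-! ### Bi-ordered groups with a least positive element. -/

/-- A bi-ordered group in which the positive elements below a given one have uniformly bounded
exponents is cyclic. -/
theorem exists_forall_mem_zpowers_of_uniform_archimedean {G : Type*} [Group G] [LinearOrder G]
    [MulLeftStrictMono G] [MulRightStrictMono G]
    (h : ∀ f : G, 1 < f → ∃ N : ℕ, ∀ g : G, 1 < g → f < g ^ N) :
    ∃ g : G, ∀ x : G, x ∈ Subgroup.zpowers g := by
  classical
  have : MulLeftMono G := covariantClass_le_of_lt _ _ _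
  have : MulRightMono G := covariantClass_le_of_lt _ _ _
  by_cases htriv : ∀ f : G, ¬ 1 < f
  · refine ⟨1, fun x => ?_⟩
    have h1 : x ≤ 1 := not_lt.1 (htriv x)
    have h2 : x⁻¹ ≤ 1 := not_lt.1 (htriv _)
    rw [le_antisymm h1 (inv_le_one'.1 h2)]
    exact one_mem _
  push Not at htriv
  obtain ⟨f, hf⟩ := htriv
  have hN := Nat.find_spec (h f hf)
  have hmin := fun {m} => Nat.find_min (m := m) (h f hf)
  set N := Nat.find (h f hf)
  have hN2 : 2 ≤ N := by
    by_contra hlt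
    have := hN f hf
    interval_cases N
    · exact lt_asymm hf (by simpa using this)
    · exact absurd this (by simp)
  obtain ⟨g, hg, hgn⟩ : ∃ g : G, 1 < g ∧ g ^ (N - 1) ≤ f := by
    have := hmin (m := N - 1) (by omega)
    push Not at this
    exact this
  -- Since `N ≤ 2 * (N - 1)`, having `k ^ 2 ≤ g` would give `k ^ N ≤ g ^ (N - 1) ≤ f`.
  have hsq : ∀ k : G, 1 < k → g < k ^ 2 := by
    intro k hk
    by_contra hle
    have h1 : (k ^ 2) ^ (N - 1) ≤ g ^ (N - 1) := pow_le_pow_left' (not_lt.1 hle) _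
    have h2 : k ^ N ≤ (k ^ 2) ^ (N - 1) := by
      rw [← pow_mul]
      exact pow_le_pow_right' hk.le (by omega)
    exact absurd (hN k hk) (not_lt.2 ((h2.trans h1).trans hgn))
  -- If `1 < k < g`, then `g < k ^ 2` gives `k⁻¹ * g < k`, so the square of `k⁻¹ * g` is below `g`,
  -- against `hsq`.
  have hleast : ∀ k : G, 1 ≤ k → k < g → k = 1 := by
    intro k hk hkg
    by_contra hne
    have hk1 : 1 < k := lt_of_le_of_ne hk (Ne.symm hne)
    have h1 : 1 < k⁻¹ * g := by rwa [lt_inv_mul_iff_mul_lt, mul_one]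
    have h2 : k⁻¹ * g < k := by
      rw [inv_mul_lt_iff_lt_mul, ← pow_two]
      exact hsq k hk1
    have h3 := hsq _ h1
    rw [pow_two] at h3
    have h4 : k⁻¹ * g * (k⁻¹ * g) < k * (k⁻¹ * g) := mul_lt_mul_left h2 _
    rw [mul_inv_cancel_left] at h4
    exact absurd (h3.trans h4) (lt_irrefl _)
  have hpos : ∀ x : G, 1 < x → x ∈ Subgroup.zpowers g := by
    intro x hx
    obtain ⟨n, hn⟩ := h x hx
    have hex : ∃ n, x < g ^ n := ⟨n, hn g hg⟩
    have hs := Nat.find_spec hex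
    have hm := fun {m} => Nat.find_min (m := m) hex
    set n := Nat.find hex
    have hn1 : n ≠ 0 := by
      intro h0
      rw [h0, pow_zero] at hs
      exact absurd (hs.trans hx) (lt_irrefl _)
    obtain ⟨k, hk⟩ := Nat.exists_eq_succ_of_ne_zero hn1
    have hk1 : g ^ k ≤ x := not_lt.1 (hm (m := k) (by omega))
    have h5 : (g ^ k)⁻¹ * x = 1 := by
      apply hleast
      · rwa [le_inv_mul_iff_mul_le, mul_one]
      · rw [inv_mul_lt_iff_lt_mul, ← pow_succ]
        rwa [hk] at hs
    rw [inv_mul_eq_one] at h5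
    rw [← h5]
    exact Subgroup.npow_mem_zpowers _ _
  refine ⟨g, fun x => ?_⟩
  rcases lt_trichotomy x 1 with hx | rfl | hx
  · rw [← inv_mem_iff]
    exact hpos _ (one_lt_inv'.2 hx)
  · exact one_mem _
  · exact hpos x hx

/-! ### Contractions near a fixed point and their distortion. -/

/-- Order automorphisms of the line contract the iterates of a point towards the first fixed point
below it. -/
theorem OrderIso.tendsto_pow_apply {F : ℝ ≃o ℝ} {q c : ℝ} (hq : F q = q) (hqc : q < c)
    (hF : ∀ x ∈ Ioc q c, F x < x) : Tendsto (fun m : ℕ => (F ^ m) c) atTop (𝓝[>] q) := by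
  have hmem : ∀ m : ℕ, (F ^ m) c ∈ Ioc q c := by
    intro m
    induction m with
    | zero => exact ⟨hqc, le_rfl⟩
    | succ m ih =>
      rw [pow_succ', RelIso.mul_apply]
      exact ⟨by simpa [hq] using F.strictMono ih.1, (hF _ ih).le.trans ih.2⟩
  have hanti : Antitone fun m : ℕ => (F ^ m) c := by
    refine antitone_nat_of_succ_le fun m => ?_
    rw [pow_succ', RelIso.mul_apply]
    exact (hF _ (hmem m)).le
  have hbdd : BddBelow (range fun m : ℕ => (F ^ m) c) :=
    ⟨q, by rintro _ ⟨m, rfl⟩; exact (hmem m).1.le⟩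
  have hlim := tendsto_atTop_ciInf hanti hbdd
  set l := ⨅ m : ℕ, (F ^ m) c
  have hfix : F l = l := by
    have h1 : Tendsto (fun m : ℕ => F ((F ^ m) c)) atTop (𝓝 (F l)) :=
      (F.continuous.tendsto l).comp hlim
    have h2 := hlim.comp (tendsto_add_atTop_nat 1)
    refine tendsto_nhds_unique h1 (h2.congr fun m => ?_)
    simp [pow_succ']
  have hl : l = q := by
    by_contra hne
    have hql : q ≤ l := ge_of_tendsto' hlim fun m => (hmem m).1.le
    have hlc : l ≤ c := le_of_tendsto' hlim fun m => (hmem m).2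
    exact absurd hfix (hF l ⟨lt_of_le_of_ne hql (Ne.symm hne), hlc⟩).ne
  rw [← hl, tendsto_nhdsWithin_iff]
  exact ⟨hlim, Eventually.of_forall fun m => by rw [hl]; exact (hmem m).1⟩

/-- A differentiable order automorphism with differentiable inverse has positive derivative. -/
theorem OrderIso.deriv_pos_of_differentiable {F : ℝ ≃o ℝ} (hF : Differentiable ℝ F)
    (hF' : Differentiable ℝ (F⁻¹ : ℝ ≃o ℝ)) (x : ℝ) : 0 < deriv F x := by
  refine lt_of_le_of_ne F.monotone.deriv_nonneg fun h0 => ?_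
  have h1 : HasDerivAt (fun y => (F⁻¹ : ℝ ≃o ℝ) (F y)) (deriv (F⁻¹ : ℝ ≃o ℝ) (F x) * deriv F x) x :=
    HasDerivAt.comp x (hF' _).hasDerivAt (hF x).hasDerivAt
  simp only [RelIso.inv_apply_self] at h1
  have := h1.unique (hasDerivAt_id' x)
  rw [← h0] at this
  simp at this

/-- Bounded distortion: the iterates of a contraction have comparable derivatives at any two points
of the union of three fundamental domains. -/
theorem OrderIso.exists_deriv_pow_le {F : ℝ ≃o ℝ} {q c : ℝ} (hq : F q = q) (hqc : q < c)
    (hF : ∀ x ∈ Ioc q c, F x < x) (hsm : ContDiff ℝ 2 F) (hpos : ∀ x, 0 < deriv F x) :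
    ∃ M : ℝ, 0 < M ∧ ∀ m : ℕ, ∀ x ∈ Icc ((F ^ 3) c) c, ∀ y ∈ Icc ((F ^ 3) c) c,
      deriv (F ^ m : ℝ ≃o ℝ) x ≤ M * deriv (F ^ m : ℝ ≃o ℝ) y := by
  have hlog : ContDiff ℝ 1 fun x => Real.log (deriv F x) :=
    ContDiff.log ((contDiff_succ_iff_deriv (n := 1)).1 hsm).2.2 fun x => (hpos x).ne'
  obtain ⟨K, hK⟩ := hlog.contDiffOn.exists_lipschitzOnWith one_ne_zero (convex_Icc q c)
    isCompact_Icc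
  have hstep : ∀ x ∈ Icc q c, ∀ y ∈ Icc q c,
      deriv F x ≤ deriv F y * Real.exp (K * |x - y|) := by
    intro x hx y hy
    have h1 := (le_abs_self _).trans (hK.dist_le_mul x hx y hy)
    rw [Real.dist_eq] at h1
    rw [← Real.exp_log (hpos x), ← Real.exp_log (hpos y), ← Real.exp_add, Real.exp_le_exp]
    linarith
  have hd : ∀ m : ℕ, Differentiable ℝ (F ^ m : ℝ ≃o ℝ) := by
    intro m
    induction m with
    | zero => exact differentiable_id
    | succ m ih =>
      rw [pow_succ', RelIso.coe_mul]
      exact (hsm.differentiable (by norm_num)).comp ih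
  have hmem : ∀ m : ℕ, ∀ x ∈ Icc q c, (F ^ m) x ∈ Icc q c := by
    intro m x hx
    induction m with
    | zero => exact hx
    | succ m ih =>
      rw [pow_succ', RelIso.mul_apply]
      refine ⟨by simpa [hq] using F.monotone ih.1, ?_⟩
      rcases eq_or_lt_of_le ih.1 with h | h
      · rw [← h, hq]; exact hqc.le
      · exact (hF _ ⟨h, ih.2⟩).le.trans ih.2
  have hder : ∀ (m : ℕ) (x : ℝ), deriv (F ^ (m + 1) : ℝ ≃o ℝ) x =
      deriv F ((F ^ m) x) * deriv (F ^ m : ℝ ≃o ℝ) x := by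
    intro m x
    rw [pow_succ', RelIso.coe_mul]
    exact deriv_comp x (hsm.differentiable (by norm_num) _) (hd m x)
  have hiter : ∀ m : ℕ, ∀ x ∈ Icc q c, ∀ y ∈ Icc q c, deriv (F ^ m : ℝ ≃o ℝ) x ≤
      deriv (F ^ m : ℝ ≃o ℝ) y *
        Real.exp (K * ∑ i ∈ Finset.range m, |(F ^ i) x - (F ^ i) y|) := by
    intro m x hx y hy
    induction m with
    | zero => simp
    | succ m ih =>
      rw [hder, hder, Finset.sum_range_succ, mul_add, Real.exp_add]
      calc _ ≤ (deriv F ((F ^ m) y) * Real.exp (K * |(F ^ m) x - (F ^ m) y|)) *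
            (deriv (F ^ m : ℝ ≃o ℝ) y *
              Real.exp (K * ∑ i ∈ Finset.range m, |(F ^ i) x - (F ^ i) y|)) :=
          mul_le_mul (hstep _ (hmem m x hx) _ (hmem m y hy)) ih
            (F ^ m : ℝ ≃o ℝ).monotone.deriv_nonneg
            (mul_nonneg (hpos _).le (Real.exp_pos _).le)
        _ = _ := by ring
  refine ⟨Real.exp (K * (3 * (c - q))), Real.exp_pos _, fun m x hx y hy => ?_⟩
  have hc : c ∈ Icc q c := ⟨hqc.le, le_rfl⟩
  have hx' : x ∈ Icc q c := ⟨(hmem 3 c hc).1.trans hx.1, hx.2⟩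
  have hy' : y ∈ Icc q c := ⟨(hmem 3 c hc).1.trans hy.1, hy.2⟩
  -- Each term is at most `(F ^ i) c - (F ^ (i + 3)) c`, and these differences telescope with step
  -- three.
  have hsum : ∀ m : ℕ, ∑ i ∈ Finset.range m, |(F ^ i) x - (F ^ i) y| ≤
      (c + (F ^ 1) c + (F ^ 2) c) - ((F ^ m) c + (F ^ (m + 1)) c + (F ^ (m + 2)) c) := by
    intro m
    induction m with
    | zero => simp
    | succ m ih =>
      have h3 : ∀ z ∈ Icc ((F ^ 3) c) c, (F ^ (m + 3)) c ≤ (F ^ m) z ∧ (F ^ m) z ≤ (F ^ m) c := by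
        intro z hz
        rw [pow_add, RelIso.mul_apply]
        exact ⟨(F ^ m).monotone hz.1, (F ^ m).monotone hz.2⟩
      have h4 : |(F ^ m) x - (F ^ m) y| ≤ (F ^ m) c - (F ^ (m + 3)) c := by
        rw [abs_le]
        constructor <;> linarith [h3 x hx, h3 y hy]
      rw [Finset.sum_range_succ]
      have h5 : m + 1 + 1 = m + 2 := rfl
      have h6 : m + 1 + 2 = m + 3 := rfl
      rw [h5, h6]
      linarith
  refine (hiter m x hx' y hy').trans ?_
  rw [mul_comm]
  refine mul_le_mul_of_nonneg_right (Real.exp_le_exp.2 ?_) (F ^ m : ℝ ≃o ℝ).monotone.deriv_nonneg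
  refine mul_le_mul_of_nonneg_left ((hsum m).trans ?_) K.2
  linarith [(hmem m c hc).1, (hmem (m + 1) c hc).1, (hmem (m + 2) c hc).1, (hmem 1 c hc).2,
    (hmem 2 c hc).2]

/-! ### Gaps of the invariant set and the exponent bound. -/

/-- A point outside a closed set, between two points of this set, lies in a bounded gap. -/
theorem IsClosed.exists_gap {C : Set ℝ} (hC : IsClosed C) {a b y : ℝ} (ha : a ∈ C) (hb : b ∈ C)
    (hay : a ≤ y) (hyb : y ≤ b) (hy : y ∉ C) :
    ∃ u ∈ C, ∃ v ∈ C, a ≤ u ∧ u < y ∧ y < v ∧ v ≤ b ∧ Disjoint (Ioo u v) C := by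
  obtain ⟨u, ⟨⟨hau, huy⟩, huC⟩, hu⟩ := (isCompact_Icc.inter_right hC).exists_isGreatest
    (⟨a, ⟨le_rfl, hay⟩, ha⟩ : (Icc a y ∩ C).Nonempty)
  obtain ⟨v, ⟨⟨hyv, hvb⟩, hvC⟩, hv⟩ := (isCompact_Icc.inter_right hC).exists_isLeast
    (⟨b, ⟨hyb, le_rfl⟩, hb⟩ : (Icc y b ∩ C).Nonempty)
  refine ⟨u, huC, v, hvC, hau, huy.lt_of_ne fun h => hy (h ▸ huC),
    hyv.lt_of_ne fun h => hy (h ▸ hvC), hvb, disjoint_left.2 fun z hz hzC => ?_⟩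
  rcases le_total z y with h | h
  · exact hz.1.not_ge (hu ⟨⟨hau.trans hz.1.le, h⟩, hzC⟩)
  · exact hz.2.not_ge (hv ⟨⟨h, hz.2.le.trans hvb⟩, hzC⟩)

/-- If `F` contracts towards `q`, a group of analytic automorphisms fixing `q` and preserving a
closed set with empty interior which accumulates at `q` has no element whose `N`-th power is
closer to the identity than `F`, for `N` large. -/
theorem exists_pow_bound {H : Subgroup (ℝ ≃o ℝ)} {q : ℝ} {C : Set ℝ}
    (hA : ∀ F ∈ H, ContDiff ℝ ω F) (hq : ∀ F ∈ H, F q = q)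
    (hC : IsClosed C) (hinv : ∀ F ∈ H, ∀ x ∈ C, F x ∈ C) (hint : interior C = ∅)
    (hacc : ∃ᶠ x in 𝓝[>] q, x ∈ C) {F : ℝ ≃o ℝ} (hFH : F ∈ H)
    (hF : ∀ᶠ x in 𝓝[>] q, F x < x) :
    ∃ N : ℕ, ∀ g ∈ H, (∀ᶠ x in 𝓝[>] q, g x < x) → ¬ ∀ᶠ x in 𝓝[>] q, F x ≤ (g ^ N) x := by
  have hdiff : ∀ G ∈ H, Differentiable ℝ G := fun G hG => (hA G hG).differentiable (by simp)
  have hpos : ∀ G ∈ H, ∀ x, 0 < deriv G x := fun G hG =>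
    OrderIso.deriv_pos_of_differentiable (hdiff G hG) (hdiff _ (inv_mem hG))
  obtain ⟨b, hb, hFb⟩ := mem_nhdsGT_iff_exists_Ioo_subset.1 hF
  obtain ⟨c, hcC, hqc, hcb⟩ :=
    (hacc.and_eventually (Ioo_mem_nhdsGT hb)).exists
  have hFc : ∀ x ∈ Ioc q c, F x < x := fun x hx => hFb ⟨hx.1, hx.2.trans_lt hcb⟩
  have hqF := hq F hFH
  obtain ⟨M, hM, hdist⟩ := OrderIso.exists_deriv_pow_le hqF hqc hFc ((hA F hFH).of_le le_top)
    (hpos F hFH)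
  have hpow_gt : ∀ m : ℕ, q < (F ^ m) c := fun m => by
    simpa [hq _ (pow_mem hFH m)] using (F ^ m).strictMono hqc
  have hanti : StrictAnti fun m : ℕ => (F ^ m) c := by
    have : ∀ m : ℕ, (F ^ m) c ≤ c := by
      intro m
      induction m with
      | zero => exact le_rfl
      | succ m ih =>
        rw [pow_succ', RelIso.mul_apply]
        exact (hFc _ ⟨hpow_gt m, ih⟩).le.trans ih
    refine strictAnti_nat_of_succ_lt fun m => ?_
    rw [pow_succ', RelIso.mul_apply]
    exact hFc _ ⟨hpow_gt m, this m⟩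
  have h10 : F c < c := hFc c ⟨hqc, le_rfl⟩
  have h21 : (F ^ 2) c < F c := by simpa using hanti (show 1 < 2 by norm_num)
  have h32 : (F ^ 3) c < (F ^ 2) c := hanti (show 2 < 3 by norm_num)
  have hFF : (F ^ 2) c = F (F c) := by rw [pow_two, RelIso.mul_apply]
  obtain ⟨y, hyI, hyC⟩ : ∃ y ∈ Ioo (F c) c, y ∉ C := by
    by_contra! hsub
    have := interior_maximal hsub isOpen_Ioo
    rw [hint, subset_empty_iff, Ioo_eq_empty_iff] at this
    exact this h10
  obtain ⟨u, huC, v, hvC, hFu, huy, hyv, hvc, hgap⟩ :=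
    hC.exists_gap (hinv F hFH c hcC) hcC hyI.1.le hyI.2.le hyC
  have huv : u < v := huy.trans hyv
  set l := F c - (F ^ 2) c with hl
  -- A lower bound for the lengths of the images of the gap `(u, v)`; it depends on `F` only, so `N`
  -- can be fixed before `g`.
  set η := l * (v - u) / (2 * M ^ 2 * (c - (F ^ 2) c)) with hη
  have hlpos : 0 < l := sub_pos.2 h21
  have hDpos : 0 < c - (F ^ 2) c := by linarith
  have hηpos : 0 < η := div_pos (mul_pos hlpos (sub_pos.2 huv)) (by positivity)
  obtain ⟨N, hN⟩ := exists_nat_gt ((c - q) / η)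
  refine ⟨N, fun g hg hgq hgN => ?_⟩
  -- The factors `2 / 3` and `4 / 3` make two values of the derivative of `g ^ j` near `q` differ by
  -- a factor at most `2`.
  have hclose : ∀ᶠ x in 𝓝[>] q, ∀ j ∈ Finset.range (N + 1),
      2 / 3 * deriv (g ^ j : ℝ ≃o ℝ) q < deriv (g ^ j : ℝ ≃o ℝ) x ∧
        deriv (g ^ j : ℝ ≃o ℝ) x < 4 / 3 * deriv (g ^ j : ℝ ≃o ℝ) q := by
    refine nhdsWithin_le_nhds ((Finset.eventually_all _).2 fun j _ => ?_)
    have hgj := pow_mem hg j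
    have hcont : ContinuousAt (deriv (g ^ j : ℝ ≃o ℝ)) q :=
      ((hA _ hgj).continuous_deriv (by simp)).continuousAt
    have hp := hpos _ hgj q
    exact (hcont.eventually (lt_mem_nhds (by linarith))).and
      (hcont.eventually (gt_mem_nhds (by linarith)))
  obtain ⟨d, hd, hdsub⟩ := mem_nhdsGT_iff_exists_Ioo_subset.1 (hgq.and (hgN.and hclose))
  obtain ⟨m, hm⟩ := ((OrderIso.tendsto_pow_apply hqF hqc hFc).eventually
    (Ioo_mem_nhdsGT hd)).exists
  have hsmall : ∀ x ∈ Ioc q c, (F ^ m) x ∈ Ioo q d := fun x hx =>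
    ⟨by simpa [hq _ (pow_mem hFH m)] using (F ^ m).strictMono hx.1,
      ((F ^ m).monotone hx.2).trans_lt hm.2⟩
  set φ : ℝ ≃o ℝ := (F ^ m)⁻¹ * g * F ^ m with hφ
  have hφH : φ ∈ H := mul_mem (mul_mem (inv_mem (pow_mem hFH m)) hg) (pow_mem hFH m)
  have hφpow : ∀ j : ℕ, F ^ m * φ ^ j = g ^ j * F ^ m := by
    intro j
    have : φ ^ j = (F ^ m)⁻¹ * g ^ j * F ^ m := by
      have := conj_pow (i := j) (a := (F ^ m)⁻¹) (b := g)
      rwa [inv_inv] at this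
    rw [this, mul_assoc, mul_inv_cancel_left]
  have hφapp : ∀ (j : ℕ) (x : ℝ), (F ^ m) ((φ ^ j) x) = (g ^ j) ((F ^ m) x) := fun j x => by
    rw [← RelIso.mul_apply, hφpow, RelIso.mul_apply]
  have hφlt : ∀ x ∈ Ioc q c, φ x < x := by
    intro x hx
    rw [← (F ^ m).lt_iff_lt]
    have := hφapp 1 x
    rw [pow_one, pow_one] at this
    rw [this]
    exact (hdsub (hsmall x hx)).1
  have hφN : ∀ x ∈ Ioc q c, F x ≤ (φ ^ N) x := by
    intro x hx
    rw [← (F ^ m).le_iff_le, hφapp, ← RelIso.mul_apply, pow_mul_comm', RelIso.mul_apply]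
    exact (hdsub (hsmall x hx)).2.1
  have hφmem : ∀ j : ℕ, ∀ x ∈ Ioc q c, (φ ^ j) x ∈ Ioc q x := by
    intro j x hx
    refine ⟨by simpa [hq _ (pow_mem hφH j)] using (φ ^ j).strictMono hx.1, ?_⟩
    induction j with
    | zero => exact le_rfl
    | succ j ih =>
      rw [pow_succ', RelIso.mul_apply]
      refine (hφlt _ ⟨?_, ih.trans hx.2⟩).le.trans ih
      simpa [hq _ (pow_mem hφH j)] using (φ ^ j).strictMono hx.1
  have hφge : ∀ j ≤ N, ∀ x ∈ Ioc q c, F x ≤ (φ ^ j) x := by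
    intro j hj x hx
    refine (hφN x hx).trans ?_
    obtain ⟨k, rfl⟩ := Nat.exists_eq_add_of_le' hj
    rw [pow_add, RelIso.mul_apply]
    have := hφmem j x hx
    exact (hφmem k _ ⟨this.1, this.2.trans hx.2⟩).2
  have hderiv : ∀ (j : ℕ) (x : ℝ), deriv (F ^ m : ℝ ≃o ℝ) ((φ ^ j) x) *
      deriv (φ ^ j : ℝ ≃o ℝ) x = deriv (g ^ j : ℝ ≃o ℝ) ((F ^ m) x) *
        deriv (F ^ m : ℝ ≃o ℝ) x := by
    intro j x
    rw [← deriv_comp x (hdiff _ (pow_mem hFH m) _) (hdiff _ (pow_mem hφH j) _),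
      ← deriv_comp x (hdiff _ (pow_mem hg j) _) (hdiff _ (pow_mem hFH m) _),
      ← RelIso.coe_mul, ← RelIso.coe_mul, hφpow]
  -- Conjugation uses the distortion of `F ^ m` twice, whence `M ^ 2`. Since `F ≤ φ ^ j`, points
  -- above `(F ^ 2) c` stay above `(F ^ 3) c`, which is why three fundamental domains are needed.
  have hφdist : ∀ j ≤ N, ∀ x ∈ Icc ((F ^ 2) c) c, ∀ y ∈ Icc ((F ^ 2) c) c,
      deriv (φ ^ j : ℝ ≃o ℝ) x ≤ 2 * M ^ 2 * deriv (φ ^ j : ℝ ≃o ℝ) y := by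
    intro j hj x hx y hy
    have hI : ∀ z ∈ Icc ((F ^ 2) c) c, z ∈ Ioc q c := fun z hz => ⟨(hpow_gt 2).trans_le hz.1, hz.2⟩
    have hI3 : ∀ z ∈ Icc ((F ^ 2) c) c, z ∈ Icc ((F ^ 3) c) c := fun z hz =>
      ⟨h32.le.trans hz.1, hz.2⟩
    have hφI : ∀ z ∈ Icc ((F ^ 2) c) c, (φ ^ j) z ∈ Icc ((F ^ 3) c) c := by
      intro z hz
      refine ⟨?_, (hφmem j z (hI z hz)).2.trans hz.2⟩
      refine le_trans ?_ (hφge j hj z (hI z hz))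
      rw [pow_succ', RelIso.mul_apply]
      exact F.monotone hz.1
    have hgx := (hdsub (hsmall x (hI x hx))).2.2 j (by simpa [Nat.lt_succ_iff] using hj)
    have hgy := (hdsub (hsmall y (hI y hy))).2.2 j (by simpa [Nat.lt_succ_iff] using hj)
    have hg0 := hpos _ (pow_mem hg j) q
    have e1 := hdist m x (hI3 x hx) y (hI3 y hy)
    have e2 := hdist m _ (hφI y hy) _ (hφI x hx)
    have p1 := hpos _ (pow_mem hFH m) ((φ ^ j) x)
    have p2 := hpos _ (pow_mem hFH m) x
    have p3 := hpos _ (pow_mem hφH j) y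
    have p4 := hpos _ (pow_mem hFH m) y
    have d1 := hderiv j x
    have d2 := hderiv j y
    refine le_of_mul_le_mul_left ?_ p1
    rw [d1]
    calc deriv (g ^ j : ℝ ≃o ℝ) ((F ^ m) x) * deriv (F ^ m : ℝ ≃o ℝ) x
        ≤ (2 * deriv (g ^ j : ℝ ≃o ℝ) ((F ^ m) y)) * (M * deriv (F ^ m : ℝ ≃o ℝ) y) :=
          mul_le_mul (by linarith [hgx.2, hgy.1]) e1 p2.le (by linarith [hgy.1])
      _ = 2 * M * (deriv (F ^ m : ℝ ≃o ℝ) ((φ ^ j) y) * deriv (φ ^ j : ℝ ≃o ℝ) y) := by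
          rw [d2]; ring
      _ ≤ 2 * M * ((M * deriv (F ^ m : ℝ ≃o ℝ) ((φ ^ j) x)) * deriv (φ ^ j : ℝ ≃o ℝ) y) := by
          gcongr
      _ = _ := by ring
  have huI : u ∈ Icc ((F ^ 2) c) c := ⟨h21.le.trans hFu, (huv.trans_le hvc).le⟩
  have hvI : v ∈ Icc ((F ^ 2) c) c := ⟨huI.1.trans huv.le, hvc⟩
  have hqF2 : q < (F ^ 2) c := hpow_gt 2
  have hcIoc : c ∈ Ioc q c := ⟨hqc, le_rfl⟩
  have hlen : ∀ j ≤ N, η ≤ (φ ^ j) v - (φ ^ j) u := by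
    intro j hj
    have hdφ := hdiff _ (pow_mem hφH j)
    obtain ⟨ξ, hξ, hξe⟩ := exists_deriv_eq_slope (φ ^ j : ℝ ≃o ℝ) huv
      hdφ.continuous.continuousOn hdφ.differentiableOn
    obtain ⟨ζ, hζ, hζe⟩ := exists_deriv_eq_slope (φ ^ j : ℝ ≃o ℝ) (sub_pos.1 hDpos)
      hdφ.continuous.continuousOn hdφ.differentiableOn
    have e := hφdist j hj ζ ⟨hζ.1.le, hζ.2.le⟩ ξ ⟨huI.1.trans hξ.1.le, hξ.2.le.trans hvI.2⟩
    rw [hξe, hζe] at e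
    have e1 : l ≤ (φ ^ j) c - (φ ^ j) ((F ^ 2) c) :=
      sub_le_sub (hφge j hj c hcIoc)
        (hφmem j _ ⟨hqF2, by linarith⟩).2
    have e2 : l / (c - (F ^ 2) c) ≤ 2 * M ^ 2 * (((φ ^ j) v - (φ ^ j) u) / (v - u)) :=
      (div_le_div_of_nonneg_right e1 hDpos.le).trans e
    rw [← mul_div_assoc, div_le_div_iff₀ hDpos (sub_pos.2 huv)] at e2
    rw [hη, div_le_iff₀ (by positivity)]
    linarith
  -- `φ v` lies in `C` and below `v`, so it cannot lie in the gap and is at most `u`.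
  have hjump : ∀ j : ℕ, (φ ^ (j + 1)) v ≤ (φ ^ j) u := by
    intro j
    rw [pow_succ, RelIso.mul_apply]
    refine (φ ^ j).monotone ?_
    by_contra! hlt
    exact disjoint_left.1 hgap ⟨hlt, hφlt v ⟨hqF2.trans_le hvI.1, hvI.2⟩⟩ (hinv φ hφH v hvC)
  have hdesc : ∀ j ≤ N, (φ ^ j) v ≤ v - j * η := by
    intro j hj
    induction j with
    | zero => simp
    | succ j ih =>
      have := ih (by omega)
      have := hlen j (by omega)
      have := hjump j
      push_cast
      linarith
  have h1 := hdesc N le_rfl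
  have h2 := (hφmem N v ⟨hqF2.trans_le hvI.1, hvI.2⟩).1
  rw [div_lt_iff₀ hηpos] at hN
  linarith

/-! ### The germ order and cyclicity of stabilizers. -/

/-- Two analytic functions on the line are, to the right of a point, ordered or equal. -/
theorem eventually_lt_or_eq_or_gt_of_analytic {f g : ℝ → ℝ} (hf : ContDiff ℝ ω f)
    (hg : ContDiff ℝ ω g) (q : ℝ) :
    (∀ᶠ x in 𝓝[>] q, f x < g x) ∨ f = g ∨ ∀ᶠ x in 𝓝[>] q, g x < f x := by
  have hf' := contDiff_omega_iff_analyticOnNhd.1 hf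
  have hg' := contDiff_omega_iff_analyticOnNhd.1 hg
  rcases (hf' q (mem_univ q)).eventually_eq_or_eventually_ne (hg' q (mem_univ q)) with h | h
  · exact Or.inr (Or.inl (hf'.eq_of_eventuallyEq hg' h))
  · obtain ⟨b, hb, hsub⟩ := mem_nhdsGT_iff_exists_Ioo_subset.1
      (nhdsWithin_mono q (fun x (hx : q < x) => hx.ne') h)
    have hI : Ioo q b ∈ 𝓝[>] q := Ioo_mem_nhdsGT hb
    by_cases h1 : ∀ x ∈ Ioo q b, f x < g x
    · exact Or.inl (mem_of_superset hI h1)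
    · right; right
      push Not at h1
      obtain ⟨x, hx, hxle⟩ := h1
      refine mem_of_superset hI fun y hy => ?_
      by_contra hyle
      have hyle : f y ≤ g y := not_lt.1 hyle
      obtain ⟨z, hz, hze⟩ := isPreconnected_Ioo.intermediate_value₂ hy hx
        hf.continuous.continuousOn hg.continuous.continuousOn hyle hxle
      exact hsub hz hze

theorem OrderIso.tendsto_nhdsGT_of_fixed {F : ℝ ≃o ℝ} {q : ℝ} (h : F q = q) :
    Tendsto F (𝓝[>] q) (𝓝[>] q) := by
  have h1 : Tendsto F (𝓝[>] q) (𝓝 (F q)) := F.continuous.continuousAt.tendsto.mono_left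
    nhdsWithin_le_nhds
  rw [h] at h1
  refine tendsto_nhdsWithin_iff.2 ⟨h1, eventually_mem_nhdsWithin.mono fun x hx => ?_⟩
  simpa [h] using F.strictMono hx

open Classical in
/-- The order on a group of analytic automorphisms of the line fixing `q` given by comparing the
germs to the right of `q`. -/
noncomputable abbrev germLinearOrder {H : Subgroup (ℝ ≃o ℝ)} (q : ℝ)
    (hA : ∀ F ∈ H, ContDiff ℝ ω F) : LinearOrder H where
  le F G := ∀ᶠ x in 𝓝[>] q, (F : ℝ ≃o ℝ) x ≤ (G : ℝ ≃o ℝ) x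
  le_refl F := Eventually.of_forall fun _ => le_rfl
  le_trans F G K h₁ h₂ := by filter_upwards [h₁, h₂] with x using le_trans
  le_antisymm F G h₁ h₂ := by
    rcases eventually_lt_or_eq_or_gt_of_analytic (hA F F.2) (hA G G.2) q with h | h | h
    · obtain ⟨x, hx, hx'⟩ := (h.and h₂).exists
      exact absurd hx hx'.not_gt
    · exact Subtype.ext (DFunLike.coe_injective h)
    · obtain ⟨x, hx, hx'⟩ := (h.and h₁).exists
      exact absurd hx hx'.not_gt
  le_total F G := by
    rcases eventually_lt_or_eq_or_gt_of_analytic (hA F F.2) (hA G G.2) q with h | h | h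
    · exact Or.inl (h.mono fun x => le_of_lt)
    · exact Or.inl (Eventually.of_forall fun x => (congrFun h x).le)
    · exact Or.inr (h.mono fun x => le_of_lt)
  toDecidableLE := Classical.decRel _

/-- A group of analytic automorphisms of the line which fix `q` and preserve a closed set with
empty interior accumulating at `q` from the right is cyclic. -/
theorem exists_generator_of_fixed_of_invariant {H : Subgroup (ℝ ≃o ℝ)} {q : ℝ} {C : Set ℝ}
    (hA : ∀ F ∈ H, ContDiff ℝ ω F) (hq : ∀ F ∈ H, F q = q)
    (hC : IsClosed C) (hinv : ∀ F ∈ H, ∀ x ∈ C, F x ∈ C) (hint : interior C = ∅)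
    (hacc : ∃ᶠ x in 𝓝[>] q, x ∈ C) :
    ∃ g ∈ H, ∀ F ∈ H, ∃ k : ℤ, g ^ k = F := by
  let := germLinearOrder q hA
  have hle : ∀ F G : H, F ≤ G ↔ ∀ᶠ x in 𝓝[>] q, (F : ℝ ≃o ℝ) x ≤ (G : ℝ ≃o ℝ) x :=
    fun _ _ => Iff.rfl
  have hlt : ∀ F : H, F < 1 → ∀ᶠ x in 𝓝[>] q, (F : ℝ ≃o ℝ) x < x := by
    intro F hF
    rcases eventually_lt_or_eq_or_gt_of_analytic (hA F F.2) contDiff_id q with h | h | h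
    · exact h
    · exact absurd (Subtype.ext (DFunLike.coe_injective h)) hF.ne
    · exact absurd ((hle 1 F).2 (h.mono fun x => le_of_lt)) hF.not_ge
  have : MulLeftMono H := ⟨fun K F G h => by
    rw [hle] at h ⊢
    exact h.mono fun x hx => (K : ℝ ≃o ℝ).monotone hx⟩
  -- Right invariance holds because `K` fixes `q` and so preserves the filter `𝓝[>] q`.
  have : MulRightMono H := ⟨fun K F G h => by
    rw [hle] at h
    exact (hle _ _).2 ((OrderIso.tendsto_nhdsGT_of_fixed (hq K K.2)).eventually h)⟩
  have : MulLeftStrictMono H := IsLeftCancelMul.mulLeftStrictMono_of_mulLeftMono H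
  have : MulRightStrictMono H := IsRightCancelMul.mulRightStrictMono_of_mulRightMono H
  -- Contractions are the negative elements, so `exists_pow_bound` is applied to inverses.
  obtain ⟨g, hg⟩ := exists_forall_mem_zpowers_of_uniform_archimedean (G := H) fun f hf => by
    obtain ⟨N, hN⟩ := exists_pow_bound hA hq hC hinv hint hacc (inv_mem f.2)
      (hlt f⁻¹ (inv_lt_one'.2 hf))
    refine ⟨N, fun g hg => ?_⟩
    by_contra! hle'
    refine hN _ (inv_mem g.2) (hlt g⁻¹ (inv_lt_one'.2 hg)) ?_
    have := (hle f⁻¹ (g⁻¹ ^ N)).1 (by rw [inv_pow]; exact inv_le_inv_iff.2 hle')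
    simpa using this
  refine ⟨g, g.2, fun F hF => ?_⟩
  obtain ⟨k, hk⟩ := Subgroup.mem_zpowers_iff.1 (hg ⟨F, hF⟩)
  exact ⟨k, by simpa using congrArg Subtype.val hk⟩

/-- The orbit of a point under an increasing map is monotone, so further iterates only move away
from it. -/
theorem OrderIso.abs_zpow_apply_sub_ge (g : ℝ ≃o ℝ) (t : ℝ) {k : ℤ} (hk : k ≠ 0) :
    min |g t - t| |g⁻¹ t - t| ≤ |(g ^ k) t - t| := by
  have key : ∀ (h : ℝ ≃o ℝ) (n : ℕ), |h t - t| ≤ |(h ^ (n + 1)) t - t| := by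
    intro h n
    rcases le_total t (h t) with ht | ht
    · have : ∀ n : ℕ, h t ≤ (h ^ (n + 1)) t := by
        intro n
        induction n with
        | zero => simp
        | succ n ih =>
          rw [pow_succ', RelIso.mul_apply]
          exact h.monotone (ht.trans ih)
      rw [abs_of_nonneg (by linarith), abs_of_nonneg (by linarith [this n])]
      linarith [this n]
    · have : ∀ n : ℕ, (h ^ (n + 1)) t ≤ h t := by
        intro n
        induction n with
        | zero => simp
        | succ n ih =>
          rw [pow_succ', RelIso.mul_apply]
          exact h.monotone (ih.trans ht)
      rw [abs_of_nonpos (by linarith), abs_of_nonpos (by linarith [this n])]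
      linarith [this n]
  rcases lt_or_gt_of_ne hk with h | h
  · obtain ⟨n, rfl⟩ : ∃ n : ℕ, k = -((n + 1 : ℕ) : ℤ) := ⟨(-k - 1).toNat, by omega⟩
    rw [zpow_neg, zpow_natCast, ← inv_pow]
    exact (min_le_right _ _).trans (key _ n)
  · obtain ⟨n, rfl⟩ : ∃ n : ℕ, k = ((n + 1 : ℕ) : ℤ) := ⟨(k - 1).toNat, by omega⟩
    rw [zpow_natCast]
    exact (min_le_left _ _).trans (key _ n)

/-! ### Cantor sets in the circle and lifts to the line. -/

/-- In `ℕ → Bool`, flipping the `n`-th coordinate of a point gives other points converging to it. -/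
theorem frequently_nhdsNE_of_homeomorph_cantorSet {X : Type*} [TopologicalSpace X] {C : Set X}
    (e : C ≃ₜ cantorSet) {x : X} (hx : x ∈ C) : ∃ᶠ z in 𝓝[≠] x, z ∈ C := by
  let φ := e.trans cantorSetHomeomorphNatToBool
  let s : ℕ → ℕ → Bool := fun n => Function.update (φ ⟨x, hx⟩) n (!(φ ⟨x, hx⟩ n))
  have hs : Tendsto s atTop (𝓝 (φ ⟨x, hx⟩)) := by
    refine tendsto_pi_nhds.2 fun i => tendsto_const_nhds.congr' ?_
    filter_upwards [eventually_gt_atTop i] with n hn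
    simp [s, Function.update_of_ne hn.ne]
  have hne : ∀ n, φ.symm (s n) ≠ ⟨x, hx⟩ := by
    intro n h
    have := congrFun ((φ.symm_apply_eq).1 h) n
    simp [s] at this
  have hlim : Tendsto (fun n => ((φ.symm (s n) : C) : X)) atTop (𝓝[≠] x) := by
    refine tendsto_nhdsWithin_iff.2 ⟨?_, Eventually.of_forall fun n h => hne n (Subtype.ext h)⟩
    have := (φ.symm.continuous.tendsto _).comp hs
    rw [φ.symm_apply_apply] at this
    exact (continuous_subtype_val.tendsto _).comp this
  exact hlim.frequently (Frequently.of_forall fun n => (φ.symm (s n)).2)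

theorem isTotallyDisconnected_of_homeomorph_cantorSet {X : Type*} [TopologicalSpace X] {C : Set X}
    (e : C ≃ₜ cantorSet) : IsTotallyDisconnected C := by
  have : TotallyDisconnectedSpace C :=
    (e.trans cantorSetHomeomorphNatToBool).symm.totallyDisconnectedSpace
  exact totallyDisconnectedSpace_subtype_iff.1 this

theorem Circle.interior_preimage_exp_eq_empty {C : Set Circle} (hC : IsTotallyDisconnected C) :
    interior (Circle.exp ⁻¹' C) = ∅ := by
  by_contra hne
  obtain ⟨x, hx⟩ := nonempty_iff_ne_empty.2 hne
  obtain ⟨ε, hε, hsub⟩ := Metric.mem_nhds_iff.1 (mem_interior_iff_mem_nhds.1 hx)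
  set r := min (ε / 2) 1
  have hr : 0 < r := by positivity
  have hI : Icc x (x + r) ⊆ Circle.exp ⁻¹' C := by
    refine Subset.trans (fun z hz => ?_) hsub
    rw [Metric.mem_ball, Real.dist_eq, abs_of_nonneg (by linarith [hz.1])]
    linarith [hz.2, min_le_left (ε / 2) 1]
  have hss := hC _ (image_subset_iff.2 hI)
    (isPreconnected_Icc.image _ Circle.exp.continuous.continuousOn)
  have h1 : x ∈ Icc x (x + r) := ⟨le_rfl, by linarith⟩
  have h2 : x + r ∈ Icc x (x + r) := ⟨by linarith, le_rfl⟩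
  have := Circle.exp_injOn_Icc (a := x) (b := x + r)
    (by linarith [min_le_right (ε / 2) 1, Real.pi_gt_three]) h1 h2
    (hss (mem_image_of_mem _ h1) (mem_image_of_mem _ h2))
  linarith

theorem Circle.frequently_nhdsNE_preimage_exp {C : Set Circle} {q : ℝ}
    (h : ∃ᶠ z in 𝓝[≠] (Circle.exp q), z ∈ C) : ∃ᶠ x in 𝓝[≠] q, Circle.exp x ∈ C := by
  intro hn
  refine h ?_
  rw [eventually_nhdsWithin_iff] at hn ⊢
  rw [← isLocalHomeomorph_circleExp.map_nhds_eq, eventually_map]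
  filter_upwards [hn] with x hx hne
  exact hx fun hxq => hne (by rw [hxq]; rfl)

/-- Where `F` stays within `π` of `F t₀`, the principal logarithm of `exp (i (F t - F t₀))` recovers
`F`, and that branch is analytic at `1`. -/
theorem contDiff_of_analytic_lift {f : Circle → Circle} (hf : ContMDiff (𝓡 1) (𝓡 1) ω f)
    {F : ℝ → ℝ} (hF : Continuous F) (h : ∀ t, f (Circle.exp t) = Circle.exp (F t)) :
    ContDiff ℝ ω F := by
  have hw : ContDiff ℝ ω fun t => (Circle.exp (F t) : ℂ) := by
    have h1 : ContMDiff 𝓘(ℝ, ℝ) (𝓡 1) ω fun t => f (Circle.exp t) := hf.comp contMDiff_circleExp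
    have : Fact (Module.finrank ℝ ℂ = 1 + 1) := finrank_real_complex_fact'
    have h2 : ContMDiff 𝓘(ℝ, ℝ) 𝓘(ℝ, ℂ) ω fun t => (f (Circle.exp t) : ℂ) :=
      (contMDiff_coe_sphere (E := ℂ) (n := 1)).comp h1
    simp only [h] at h2
    exact h2.contDiff
  rw [contDiff_iff_contDiffAt]
  intro t₀
  have hev : (fun t => F t₀ + (Complex.log (Circle.exp (F t) / Circle.exp (F t₀))).im) =ᶠ[𝓝 t₀]
      F := by
    filter_upwards [hF.continuousAt.eventually (Ioo_mem_nhds (sub_lt_self _ Real.pi_pos)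
      (lt_add_of_pos_right _ Real.pi_pos))] with t ht
    have : (Circle.exp (F t) / Circle.exp (F t₀) : ℂ) = Complex.exp ((F t - F t₀ : ℝ) * Complex.I) := by
      rw [← Circle.coe_exp, Circle.exp_sub, Circle.coe_div]
    rw [this, Complex.log_exp] <;> simp
    · linarith [ht.1]
    · linarith [ht.2]
  refine ContDiffAt.congr_of_eventuallyEq ?_ hev.symm
  have hlog : ContDiffAt ℝ ω Complex.log
      ((Circle.exp (F t₀) : ℂ) / Circle.exp (F t₀)) := by
    rw [div_self (Circle.coe_ne_zero _)]
    exact (Complex.contDiffAt_log (by simp)).restrict_scalars ℝ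
  have hdiv : ContDiffAt ℝ ω (fun t => (Circle.exp (F t) : ℂ) / Circle.exp (F t₀)) t₀ :=
    hw.contDiffAt.div_const _
  have h3 : ContDiffAt ℝ ω
      (fun t => Complex.log ((Circle.exp (F t) : ℂ) / Circle.exp (F t₀))) t₀ :=
    ContDiffAt.comp (g := Complex.log) t₀ hlog hdiv
  exact contDiffAt_const.add (Complex.imCLM.contDiff.contDiffAt.comp t₀ h3)

/-- A lift of an orientation-preserving circle homeomorphism which moves `t` as little as the
homeomorphism moves its image. -/
theorem IsOrientationPreserving.exists_lift {f : Circle ≃ₜ Circle} (hf : IsOrientationPreserving f)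
    (t : ℝ) : ∃ F : ℝ ≃o ℝ, (∀ s, f (Circle.exp s) = Circle.exp (F s)) ∧
      F t = t + Complex.arg (f (Circle.exp t) / Circle.exp t : Circle) := by
  obtain ⟨F, -, hF⟩ := hf
  have h : Circle.exp (t + Complex.arg (f (Circle.exp t) / Circle.exp t : Circle)) =
      Circle.exp (F t) := by
    rw [Circle.exp_add, Circle.exp_arg, mul_div_cancel, hF]
  obtain ⟨m, hm⟩ := Circle.exp_eq_exp.1 h
  refine ⟨F.trans (OrderIso.addRight (m * (2 * Real.pi))), fun s => ?_, ?_⟩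
  · rw [hF, Circle.exp_eq_exp]
    exact ⟨-m, by simp⟩
  · rw [hm]; rfl

/-- The lifts to the line fixing `q` of the elements of `Γ`. -/
def liftStabilizer (Γ : Subgroup AnalyticDiffPlus) (q : ℝ) : Subgroup (ℝ ≃o ℝ) where
  carrier := {F | F q = q ∧ ∃ f ∈ Γ, ∀ t, (f : Circle ≃ₜ Circle) (Circle.exp t) = Circle.exp (F t)}
  mul_mem' := by
    rintro F G ⟨hF, f, hf, hfF⟩ ⟨hG, g, hg, hgG⟩
    refine ⟨by simp [hF, hG], f * g, mul_mem hf hg, fun t => ?_⟩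
    simp [hgG, hfF]
  one_mem' := ⟨rfl, 1, one_mem _, fun t => rfl⟩
  inv_mem' := by
    rintro F ⟨hF, f, hf, hfF⟩
    refine ⟨F.injective (by simp [hF]), f⁻¹, inv_mem hf, fun t => ?_⟩
    change (f : Circle ≃ₜ Circle).symm _ = _
    rw [Homeomorph.symm_apply_eq, hfF, RelIso.apply_inv_self]

/-! ### The contradiction at the endpoint of a gap. -/

theorem proposition3p2 (Γ : Subgroup AnalyticDiffPlus) (hΓ : IsLocallyNondiscreteC0 Γ) :
    ¬ ∃ C : Set Circle, IsExceptionalMinimalSet Γ C := by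
  rintro ⟨C, hmin, ⟨e⟩⟩
  obtain ⟨hne, hcl, hinv⟩ := hmin.prop
  obtain ⟨I, ⟨a, b, hab, -, rfl⟩, g, hg, hlim⟩ := hΓ
  have hC : IsClosed (Circle.exp ⁻¹' C) := hcl.preimage Circle.exp.continuous
  have hint := Circle.interior_preimage_exp_eq_empty
    (isTotallyDisconnected_of_homeomorph_cantorSet e)
  obtain ⟨y, hyI, hyC⟩ : ∃ y ∈ Ioo a b, y ∉ Circle.exp ⁻¹' C := by
    by_contra! hsub
    have := interior_maximal hsub isOpen_Ioo
    rw [hint, subset_empty_iff, Ioo_eq_empty_iff] at this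
    exact this hab
  obtain ⟨z, hz⟩ := hne
  obtain ⟨s, rfl⟩ := Circle.exp_surjective z
  -- Translates of `s` by multiples of `2π` on both sides of `y` ensure that the gap around `y` is
  -- bounded.
  obtain ⟨p', hp'y, hp'⟩ := Circle.periodic_exp.exists_mem_Ioc Real.two_pi_pos s (y - 2 * Real.pi)
  obtain ⟨q', hq'y, hq'⟩ := Circle.periodic_exp.exists_mem_Ioc Real.two_pi_pos s y
  rw [sub_add_cancel] at hp'y
  obtain ⟨p, -, q, hqC, -, hpy, hyq, -, hgap⟩ := hC.exists_gap (a := p') (b := q')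
    (by rwa [mem_preimage, ← hp']) (by rwa [mem_preimage, ← hq']) hp'y.2 hq'y.1.le hyC
  -- `C` has no isolated point and the gap lies to the left of `q`, so the accumulation is from the
  -- right.
  have hacc : ∃ᶠ x in 𝓝[>] q, x ∈ Circle.exp ⁻¹' C := by
    have h1 := Circle.frequently_nhdsNE_preimage_exp
      (frequently_nhdsNE_of_homeomorph_cantorSet e hqC)
    rw [← Iio_union_Ioi, nhdsWithin_union, frequently_sup] at h1
    refine h1.resolve_left fun h => h ?_
    filter_upwards [Ioo_mem_nhdsLT (hpy.trans hyq)] with x hx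
    exact disjoint_left.1 hgap hx
  have hA : ∀ F ∈ liftStabilizer Γ q, ContDiff ℝ ω F := fun F ⟨_, f, _, hfF⟩ =>
    contDiff_of_analytic_lift f.2.1 F.continuous hfF
  obtain ⟨γ, hγ, hgen⟩ := exists_generator_of_fixed_of_invariant hA (fun F hF => hF.1) hC
    (fun F ⟨_, f, hf, hfF⟩ x hx => by
      rw [mem_preimage, ← hfF]
      exact hinv f hf _ hx) hint hacc
  -- By analyticity, a generator fixing this whole interval pointwise is the identity.
  obtain ⟨t, htI, ht⟩ : ∃ t ∈ Ioo (max a p) (min b q), γ t = t → γ = 1 := by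
    by_contra! hfix
    have hy : y ∈ Ioo (max a p) (min b q) := ⟨max_lt hyI.1 hpy, lt_min hyI.2 hyq⟩
    refine (hfix y hy).2 (DFunLike.coe_injective ?_)
    refine (contDiff_omega_iff_analyticOnNhd.1 (hA γ hγ)).eq_of_eventuallyEq
      (contDiff_omega_iff_analyticOnNhd.1 contDiff_id) (z₀ := y) ?_
    exact mem_of_superset (isOpen_Ioo.mem_nhds hy) fun x hx => (hfix x hx).1
  have hap := max_lt_iff.1 htI.1
  have hbq := lt_min_iff.1 htI.2
  choose G hG hGt using fun n => (g n).2.2.2.exists_lift t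
  have hGlim : Tendsto (fun n => G n t) atTop (𝓝 t) := by
    have h1 : Tendsto (fun n => (g n : Circle ≃ₜ Circle) (Circle.exp t)) atTop
        (𝓝 (Circle.exp t)) := hlim.tendsto_at (mem_image_of_mem _ ⟨hap.1, hbq.1⟩)
    have h2 : Tendsto (fun n => (g n : Circle ≃ₜ Circle) (Circle.exp t) / Circle.exp t) atTop
        (𝓝 1) := by
      simpa using h1.div_const' (Circle.exp t)
    have h3 : ContinuousAt (fun z : Circle => Complex.arg z) 1 :=
      ContinuousAt.comp (g := Complex.arg) (Complex.continuousAt_arg (by simp))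
        continuous_subtype_val.continuousAt
    have h4 := (h3.tendsto.comp h2).const_add t
    simp only [Circle.coe_one, Complex.arg_one, add_zero] at h4
    exact h4.congr fun n => (hGt n).symm
  have hclose : ∀ᶠ n in atTop, γ t ≠ t → |G n t - t| < min |γ t - t| |γ⁻¹ t - t| := by
    by_cases hγt : γ t = t
    · exact Eventually.of_forall fun n h => absurd hγt h
    · have hpos : 0 < min |γ t - t| |γ⁻¹ t - t| := by
        refine lt_min (abs_pos.2 (sub_ne_zero.2 hγt)) (abs_pos.2 (sub_ne_zero.2 fun h => hγt ?_))
        rw [← h, RelIso.apply_inv_self, h]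
      filter_upwards [Metric.tendsto_nhds.1 hGlim _ hpos] with n hn _
      rwa [Real.dist_eq] at hn
  obtain ⟨n, hn, hnI⟩ := (hclose.and
    (hGlim.eventually (Ioo_mem_nhds hap.2 hbq.2))).exists
  have hstep : ∀ F : ℝ ≃o ℝ, ∀ f ∈ Γ,
      (∀ s, (f : Circle ≃ₜ Circle) (Circle.exp s) = Circle.exp (F s)) → p < F q → q ≤ F q := by
    intro F f hf hfF hp
    by_contra! hlt
    refine disjoint_left.1 hgap ⟨hp, hlt⟩ ?_
    rw [mem_preimage, ← hfF]
    exact hinv f hf _ hqC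
  -- `G n` and its inverse both send `q` above `p`, hence to `q` or beyond by `hstep`.
  have hGq : G n q = q := by
    refine le_antisymm ?_ (hstep _ _ (hg n).1 (hG n) (hnI.1.trans ((G n).strictMono hbq.2)))
    have h1 : q ≤ (G n)⁻¹ q := by
      refine hstep _ _ (inv_mem (hg n).1) (fun s => ?_) ?_
      · change (g n : Circle ≃ₜ Circle).symm _ = _
        rw [Homeomorph.symm_apply_eq, hG, RelIso.apply_inv_self]
      · refine hap.2.trans ((G n).lt_iff_lt.1 ?_)
        rw [RelIso.apply_inv_self]
        exact hnI.2
    simpa using (G n).monotone h1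
  have hGne : G n ≠ 1 := by
    intro h
    refine (hg n).2 (Subtype.ext (Homeomorph.ext fun w => ?_))
    obtain ⟨s, rfl⟩ := Circle.exp_surjective w
    rw [hG, h]
    rfl
  obtain ⟨k, hk⟩ := hgen (G n) ⟨hGq, g n, (hg n).1, hG n⟩
  have hk0 : k ≠ 0 := by
    rintro rfl
    exact hGne (by rw [← hk, zpow_zero])
  have hγt : γ t ≠ t := fun h => hGne (by rw [← hk, ht h, one_zpow])
  have := γ.abs_zpow_apply_sub_ge t hk0
  rw [hk] at this
  exact absurd (hn hγt) this.not_gt
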